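/- Let $G$ be a finite simple graph with vertex set $V$, and let $\pi=\{W_1,\dots,W_t\}$ be a vertex clique-partition of $G$, that is, a partition of $V$ into nonempty sets each of which is a clique of $G$. Let $G^{\pi}$ be the clique-whiskered graph: its vertices are those of $G$ together with new, pairwise distinct vertices $w_1,\dots,w_t$, and its edge set is $E(G)\cup\bigcup_{i=1}^{t}\{\{v,w_i\} : v\in W_i\}$. For a finite simple graph $H$ and a field $K$, the edge ideal of $H$ is the ideal $I(H)=(x_ax_b : \{a,b\}\in E(H))$ of the polynomial ring $S_H=K[x_a : a\in V(H)]$. Then, for every field $K$, the edge ideal $I(G^{\pi})$ is Cohen–Macaulay, i.e. the ring $S_{G^{\pi}}/I(G^{\pi})$ is Cohen–Macaulay (it is Noetherian, and each of its localizations at a prime ideal has depth equal to its Krull dimension). Moreover, $G^{\pi}$ is the hybrid graph $G_{W_1,\dots,W_t}^{B_1,\dots,B_t}$ with singleton sets $B_i=\{w_i\}$. Here, for cliques $A_1,\dots,A_r$ of $G$ that partition $V$ (empty $A_i$ allowed) and nonempty, pairwise disjoint finite sets $B_1,\dots,B_r$ of new vertices, the hybrid graph $G_{A_1,\dots,A_r}^{B_1,\dots,B_r}$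 has vertex set $V\cup B_1\cup\dots\cup B_r$ and edge set $E(G)\cup\bigcup_{i=1}^{r}\{F\subseteq A_i\cup B_i : |F|=2\}$. -/

import Mathlib

/-! ### Cohen–Macaulay rings -/

/-- The depth of a local ring: the supremum of the lengths of the regular sequences on the ring
consisting of elements of the maximal ideal. -/
noncomputable def localDepth (R : Type*) [CommRing R] [IsLocalRing R] : ℕ∞ :=
  ⨆ rs : {rs : List R // RingTheory.Sequence.IsRegular R rs ∧
    ∀ r ∈ rs, r ∈ IsLocalRing.maximalIdeal R}, (rs.1.length : ℕ∞)

/-- A local ring is Cohen–Macaulay if it is Noetherian and its depth equals its Krull dimension. -/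
structure IsCohenMacaulayLocalRing (R : Type*) [CommRing R] [IsLocalRing R] : Prop where
  isNoetherianRing : IsNoetherianRing R
  depth_eq_dim : ((localDepth R : ℕ∞) : WithBot ℕ∞) = ringKrullDim R

/-- A commutative ring is Cohen–Macaulay if it is Noetherian and its localization at every prime
ideal is a Cohen–Macaulay local ring. -/
structure IsCohenMacaulayRing (R : Type*) [CommRing R] : Prop where
  isNoetherianRing : IsNoetherianRing R
  localization : ∀ (p : Ideal R) [p.IsPrime], IsCohenMacaulayLocalRing (Localization.AtPrime p)

namespace SimpleGraph

/-! ### Edge ideals -/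

/-- The edge ideal `I(G) = (x_a x_b : {a, b} ∈ E(G))` in the polynomial ring over `K` whose
variables are the vertices of `G`. -/
noncomputable def edgeIdeal (K : Type*) [Field K] {V : Type*} (G : SimpleGraph V) :
    Ideal (MvPolynomial V K) :=
  Ideal.span {f | ∃ a b : V, G.Adj a b ∧ f = MvPolynomial.X a * MvPolynomial.X b}

/-- `G` is Cohen–Macaulay over `K`, also phrased as: the ideal `I(G)` is Cohen–Macaulay. -/
def IsCohenMacaulayOver (K : Type*) [Field K] {V : Type*} (G : SimpleGraph V) : Prop :=
  IsCohenMacaulayRing (MvPolynomial V K ⧸ G.edgeIdeal K)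

/-! ### Hybrid graphs -/

/-- The set `A i ∪ B i` inside the disjoint union of `V` and all the `B i`. -/
def hybridBlock {V ι : Type*} (A : ι → Set V) (B : ι → Type*) (i : ι) :
    Set (V ⊕ (Σ j, B j)) :=
  Sum.inl '' A i ∪ Set.range fun b : B i => Sum.inr ⟨i, b⟩

/-- The hybrid graph: `G` together with the new vertices of all the `B i`, and all the two-element
subsets of the sets `A i ∪ B i` as additional edges. -/
def hybridGraph {V ι : Type*} (G : SimpleGraph V) (A : ι → Set V) (B : ι → Type*) :
    SimpleGraph (V ⊕ (Σ j, B j)) where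
  Adj x y := (∃ u v, G.Adj u v ∧ x = Sum.inl u ∧ y = Sum.inl v) ∨
    (x ≠ y ∧ ∃ i, x ∈ hybridBlock A B i ∧ y ∈ hybridBlock A B i)
  symm := ⟨by
    rintro x y (⟨u, v, h, rfl, rfl⟩ | ⟨h, i, hx, hy⟩)
    · exact Or.inl ⟨v, u, h.symm, rfl, rfl⟩
    · exact Or.inr ⟨h.symm, i, hy, hx⟩⟩
  loopless := ⟨by
    rintro x (⟨u, v, h, rfl, h'⟩ | ⟨h, -⟩)
    · exact h.ne (Sum.inl_injective h')
    · exact h rfl⟩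

/-! ### Clique-whiskering -/

/-- A vertex clique-partition: a partition of the vertex set into (nonempty) cliques. -/
def IsVertexCliquePartition {V : Type*} [Fintype V] [DecidableEq V] (G : SimpleGraph V)
    (π : Finpartition (Finset.univ : Finset V)) : Prop :=
  ∀ W ∈ π.parts, G.IsClique (W : Set V)

/-- Adjacency in the clique-whiskered graph. -/
def cliqueWhiskeringAdj {V : Type*} [Fintype V] [DecidableEq V] (G : SimpleGraph V)
    (π : Finpartition (Finset.univ : Finset V)) : V ⊕ π.parts → V ⊕ π.parts → Prop
  | Sum.inl u, Sum.inl v => G.Adj u v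
  | Sum.inl v, Sum.inr W => v ∈ W.1
  | Sum.inr W, Sum.inl v => v ∈ W.1
  | Sum.inr _, Sum.inr _ => False

/-- The clique-whiskered graph `G^π`: for every part `W` of `π`, one new vertex is added to `G`
and joined to exactly the vertices of `W`. -/
def cliqueWhiskering {V : Type*} [Fintype V] [DecidableEq V] (G : SimpleGraph V)
    (π : Finpartition (Finset.univ : Finset V)) : SimpleGraph (V ⊕ π.parts) where
  Adj := cliqueWhiskeringAdj G π
  symm := ⟨by
    rintro (u | U) (v | W) h
    · exact G.adj_symm h
    · exact h
    · exact h
    · exact h⟩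
  loopless := ⟨by
    rintro (u | U) h
    · exact G.loopless.irrefl u h
    · exact h⟩

end SimpleGraph

/-! In the edge ring of `G^π`, replace each `w_i` by the block sum `y_i = w_i + ∑_{v ∈ W_i} x_v`.
Since `W_i` is a clique, `x_v x_u = 0` for distinct `u, v ∈ W_i`, so the relation `x_v w_i = 0`
becomes `x_v ^ 2 = y_i x_v`. With `A = K[y_1, …, y_t]`, the edge ring is thus `A[x_v]` modulo the
edges of `G` and these quadratic relations (`deformedRingEquiv`). Every monomial reduces to an
element of `A` times a squarefree monomial, which vanishes unless its support is independent; so the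
ring is finite free over `A` on the independent sets of `G` (`deformedQuotientEquiv`). The
polynomial ring `A` is Cohen–Macaulay (`MvPolynomial.isCohenMacaulayRing`), and the property passes
to Noetherian flat integral extensions (`IsCohenMacaulayRing.of_flat_of_isIntegral`): flatness
transports regular sequences, integrality bounds heights. -/

/-! ### Depth and dimension of local rings; ascent along flat local maps. -/

namespace IsCohenMacaulayLocalRing

open IsLocalRing RingTheory.Sequence

variable {A B : Type*} [CommRing A] [CommRing B]

/-- The length of a regular sequence in a Noetherian local ring is at most the Krull dimension. -/
theorem localDepth_le_ringKrullDim [IsLocalRing A] [IsNoetherianRing A] :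
    ((localDepth A : ℕ∞) : WithBot ℕ∞) ≤ ringKrullDim A := by
  rw [← maximalIdeal_height_eq_ringKrullDim, WithBot.coe_le_coe]
  refine iSup_le fun ⟨rs, hreg, hmem⟩ => ?_
  have h := ringKrullDim_add_length_eq_ringKrullDim_of_isRegular rs hreg
  have : Nontrivial (A ⧸ Ideal.ofList rs) := by
    refine Ideal.Quotient.nontrivial_iff.mpr fun htop => ?_
    have hle : Ideal.ofList rs ≤ maximalIdeal A := Ideal.span_le.mpr hmem
    exact (maximalIdeal.isMaximal A).ne_top (top_le_iff.mp (htop ▸ hle))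
  rw [← WithBot.coe_le_coe, maximalIdeal_height_eq_ringKrullDim, ← h]
  exact le_add_of_nonneg_left ringKrullDim_nonneg_of_nontrivial

/-- A Noetherian local ring with a weakly regular sequence of length at least its dimension inside
the maximal ideal is Cohen–Macaulay. -/
theorem of_isWeaklyRegular [IsLocalRing A] [IsNoetherianRing A] (rs : List A)
    (hreg : IsWeaklyRegular A rs) (hmem : ∀ r ∈ rs, r ∈ maximalIdeal A)
    (hdim : ringKrullDim A ≤ rs.length) : IsCohenMacaulayLocalRing A where
  isNoetherianRing := inferInstance
  depth_eq_dim := by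
    refine le_antisymm localDepth_le_ringKrullDim (hdim.trans ?_)
    have := le_iSup (fun rs : {rs : List A // IsRegular A rs ∧ ∀ r ∈ rs, r ∈ maximalIdeal A} =>
      (rs.1.length : ℕ∞)) ⟨rs, .of_isWeaklyRegular_of_mem_maximalIdeal A hmem hreg, hmem⟩
    exact_mod_cast WithBot.coe_le_coe.mpr this

/-- In a Cohen–Macaulay local ring there is a regular sequence of length the Krull dimension. -/
theorem exists_isRegular [IsLocalRing A] (hA : IsCohenMacaulayLocalRing A) :
    ∃ rs : List A, IsRegular A rs ∧ (∀ r ∈ rs, r ∈ maximalIdeal A) ∧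
      ringKrullDim A = rs.length := by
  have := hA.isNoetherianRing
  have : Nonempty {rs : List A // IsRegular A rs ∧ ∀ r ∈ rs, r ∈ maximalIdeal A} :=
    ⟨⟨[], IsRegular.nil A A, by simp⟩⟩
  -- Finite dimension makes the depth finite, so the supremum is attained.
  have hlt : localDepth A < ⊤ := by
    have h : ((localDepth A : ℕ∞) : WithBot ℕ∞) < ⊤ := hA.depth_eq_dim ▸ ringKrullDim_lt_top
    exact WithBot.coe_lt_coe.mp h
  obtain ⟨⟨rs, hreg, hmem⟩, h⟩ := ENat.exists_eq_iSup_of_lt_top hlt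
  refine ⟨rs, hreg, hmem, ?_⟩
  rw [← hA.depth_eq_dim]
  exact congrArg _ h.symm

/-- A Noetherian local ring that is flat over a Cohen–Macaulay local ring of at least the same
dimension is Cohen–Macaulay. -/
theorem of_flat [IsLocalRing A] [IsLocalRing B] [IsNoetherianRing B] (hA : IsCohenMacaulayLocalRing A)
    (f : A →+* B) [IsLocalHom f] (hf : f.Flat) (hdim : ringKrullDim B ≤ ringKrullDim A) :
    IsCohenMacaulayLocalRing B := by
  algebraize [f]
  obtain ⟨rs, hreg, hmem, hlen⟩ := hA.exists_isRegular
  refine of_isWeaklyRegular _ (hreg.toIsWeaklyRegular.of_flat (S := B)) ?_ ?_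
  · simp only [List.mem_map]
    rintro _ ⟨r, hr, rfl⟩
    exact (mem_maximalIdeal _).mpr (map_mem_nonunits_iff f r |>.mpr (hmem r hr))
  · rw [List.length_map, ← hlen]
    exact hdim

theorem of_ringEquiv [IsLocalRing A] [IsLocalRing B] (hA : IsCohenMacaulayLocalRing A)
    (e : A ≃+* B) : IsCohenMacaulayLocalRing B := by
  have := hA.isNoetherianRing
  have := isNoetherianRing_of_ringEquiv A e
  have : IsLocalHom (e : A →+* B) := ⟨fun a ha => (isUnit_map_iff e a).mp ha⟩
  exact hA.of_flat (e : A →+* B) (.of_bijective e.bijective) (ringKrullDim_eq_of_ringEquiv e).ge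

end IsCohenMacaulayLocalRing

/-- Primes of an integral extension have at most the height of their contraction. -/
theorem Ideal.height_le_height_under_of_isIntegral {A R : Type*} [CommRing A] [CommRing R]
    [Algebra A R] [Algebra.IsIntegral A R] (P : Ideal R) [P.IsPrime] :
    P.height ≤ (P.comap (algebraMap A R)).height := by
  have hmono : StrictMono (PrimeSpectrum.comap (algebraMap A R)) := fun I J h =>
    Ideal.IsIntegral.comap_lt_comap (R := A) (I := I.asIdeal) (J := J.asIdeal) h
  have h := Order.height_le_height_apply_of_strictMono _ hmono ⟨P, inferInstance⟩
  rwa [← PrimeSpectrum.height_eq_orderHeight, ← PrimeSpectrum.height_eq_orderHeight] at h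

/-! ### Cohen–Macaulay rings: flat integral extensions and fields. -/

namespace IsCohenMacaulayRing

open IsLocalRing RingTheory.Sequence

/-- A Noetherian, flat, integral extension of a Cohen–Macaulay ring is Cohen–Macaulay. -/
theorem of_flat_of_isIntegral {A R : Type*} [CommRing A] [CommRing R] [IsNoetherianRing R]
    [Algebra A R] [Module.Flat A R] [Algebra.IsIntegral A R] (hA : IsCohenMacaulayRing A) :
    IsCohenMacaulayRing R where
  isNoetherianRing := inferInstance
  localization P _ := by
    have : IsNoetherianRing (Localization.AtPrime P) :=
      IsLocalization.isNoetherianRing P.primeCompl _ inferInstance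
    have hflat : (algebraMap A R).Flat := RingHom.flat_algebraMap_iff.mpr inferInstance
    refine (hA.localization (P.comap (algebraMap A R))).of_flat
      (Localization.localRingHom _ P (algebraMap A R) rfl) (hflat.localRingHom P _ rfl) ?_
    rw [IsLocalization.AtPrime.ringKrullDim_eq_height P,
      IsLocalization.AtPrime.ringKrullDim_eq_height (P.comap (algebraMap A R)), WithBot.coe_le_coe]
    exact P.height_le_height_under_of_isIntegral

theorem of_ringEquiv {A R : Type*} [CommRing A] [CommRing R] (hA : IsCohenMacaulayRing A)
    (e : A ≃+* R) : IsCohenMacaulayRing R := by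
  have := hA.isNoetherianRing
  have := isNoetherianRing_of_ringEquiv A e
  algebraize [(e : A →+* R)]
  have : Module.Flat A R := RingHom.Flat.of_bijective (f := (e : A →+* R)) e.bijective
  have : Algebra.IsIntegral A R := ⟨(e : A →+* R).isIntegral_of_surjective e.surjective⟩
  exact hA.of_flat_of_isIntegral

theorem of_field (K : Type*) [Field K] : IsCohenMacaulayRing K where
  isNoetherianRing := inferInstance
  localization p _ := by
    have : IsNoetherianRing (Localization.AtPrime p) :=
      IsLocalization.isNoetherianRing p.primeCompl _ inferInstance
    refine .of_isWeaklyRegular [] (.nil _ _) (by simp) ?_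
    rw [IsLocalization.AtPrime.ringKrullDim_eq_height p,
      Ideal.height_eq_zero_iff_eq_bot.mpr (Ideal.eq_bot_of_prime p)]
    rfl

end IsCohenMacaulayRing

/-! ### Polynomial rings over Cohen–Macaulay rings. -/

namespace Polynomial

open IsLocalRing RingTheory.Sequence

variable {R : Type*} [CommRing R]

/-- A regular sequence of constants can be extended by a monic polynomial. -/
theorem isWeaklyRegular_map_C_append_monic {rs : List R} (hrs : IsWeaklyRegular R rs) {f : R[X]}
    (hf : f.Monic) : IsWeaklyRegular R[X] (rs.map C ++ [f]) := by
  rw [isWeaklyRegular_append_iff, isWeaklyRegular_singleton_iff]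
  refine ⟨hrs.of_flat (S := R[X]), ?_⟩
  rw [isSMulRegular_quotient_iff_mem_of_smul_mem]
  intro g hg
  -- Modulo the constants the ring is `(R/I)[X]`, where the image of `f` is still monic, hence a
  -- nonzerodivisor.
  rw [smul_eq_mul, Ideal.mul_top, ← Ideal.map_ofList,
    ← Ideal.mk_ker (I := Ideal.ofList rs), ← ker_mapRingHom, RingHom.mem_ker] at hg ⊢
  rw [smul_eq_mul, map_mul, coe_mapRingHom] at hg
  rwa [coe_mapRingHom, ← (hf.map (Ideal.Quotient.mk (Ideal.ofList rs))).mul_right_eq_zero_iff]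

/-- The fibre over the closed point is a polynomial ring over a field, so `p` is either the
extension of the maximal ideal or that extension plus one monic polynomial. In both cases a regular
sequence of `R`, lengthened by that polynomial in the second, reaches the height of `p`. -/
theorem isCohenMacaulayLocalRing_of_comap_eq_maximalIdeal [IsLocalRing R]
    (hR : IsCohenMacaulayLocalRing R) (p : Ideal R[X]) [p.IsPrime]
    (hp : p.comap C = maximalIdeal R) : IsCohenMacaulayLocalRing (Localization.AtPrime p) := by
  have := hR.isNoetherianRing
  have : IsNoetherianRing (Localization.AtPrime p) :=
    IsLocalization.isNoetherianRing p.primeCompl _ inferInstance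
  obtain ⟨rs, hreg, hmem, hlen⟩ := hR.exists_isRegular
  rw [← maximalIdeal_height_eq_ringKrullDim] at hlen
  have key : ∀ ss : List R[X], IsWeaklyRegular R[X] ss → (∀ s ∈ ss, s ∈ p) →
      p.height ≤ ss.length → IsCohenMacaulayLocalRing (Localization.AtPrime p) := by
    intro ss hss hsp hht
    have h := hss.isRegular_of_isLocalization_of_mem (Localization.AtPrime p) p hsp
    refine .of_isWeaklyRegular _ h.toIsWeaklyRegular ?_ ?_
    · simp only [List.mem_map]
      rintro _ ⟨s, hs, rfl⟩
      exact (IsLocalization.AtPrime.to_map_mem_maximal_iff _ p s).mpr (hsp s hs)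
    · rw [IsLocalization.AtPrime.ringKrullDim_eq_height p, List.length_map]
      exact_mod_cast WithBot.coe_le_coe.mpr hht
  have hC : ∀ s ∈ rs.map C, s ∈ p := by
    simp only [List.mem_map]
    rintro _ ⟨r, hr, rfl⟩
    exact (hp ▸ hmem r hr : r ∈ p.comap C)
  have hlen' : (maximalIdeal R).height = rs.length := by exact_mod_cast hlen
  by_cases heq : p = (p.comap C).map C
  · refine key (rs.map C) (hreg.toIsWeaklyRegular.of_flat (S := R[X])) hC ?_
    rw [heq, hp, height_map_C, hlen', List.length_map]
  · obtain ⟨f, hf, hpf⟩ := exists_monic_span_sup_map_eq R p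
      (hp ▸ maximalIdeal.isMaximal R) heq
    have hfp : f ∈ p := hpf ▸ Ideal.mem_sup_right (Ideal.mem_span_singleton_self f)
    refine key (rs.map C ++ [f]) (isWeaklyRegular_map_C_append_monic hreg.toIsWeaklyRegular hf)
      ?_ ?_
    · intro s hs
      rcases List.mem_append.mp hs with h | h
      · exact hC s h
      · rwa [List.mem_singleton.mp h]
    -- The height of `p` exceeds that of the maximal ideal by at most the height of its image in the
    -- fibre, which is principal and proper, hence of height at most one.
    · have : p.LiesOver (maximalIdeal R) := ⟨hp.symm⟩
      refine (Ideal.height_le_height_add_of_liesOver (maximalIdeal R) p).trans ?_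
      rw [hlen', List.length_append, List.length_map, List.length_singleton, Nat.cast_add]
      gcongr
      have hle : (maximalIdeal R).map (algebraMap R R[X]) ≤ p := by
        rw [Ideal.map_le_iff_le_comap]
        exact hp.ge
      have hne : p.map (Ideal.Quotient.mk ((maximalIdeal R).map (algebraMap R R[X]))) ≠ ⊤ := by
        have := Ideal.map_isPrime_of_surjective (Ideal.Quotient.mk_surjective
          (I := (maximalIdeal R).map (algebraMap R R[X]))) (I := p) (by rwa [Ideal.mk_ker])
        exact this.ne_top
      have hspan : p.map (Ideal.Quotient.mk ((maximalIdeal R).map (algebraMap R R[X]))) =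
          Ideal.span {Ideal.Quotient.mk _ f} := by
        conv_lhs => rw [hpf, hp]
        rw [Ideal.map_sup, ← algebraMap_eq, Ideal.map_quotient_self, bot_sup_eq, Ideal.map_span,
          Set.image_singleton]
      rw [hspan] at hne ⊢
      exact_mod_cast Ideal.height_span_singleton_le_one
        (fun h => hne (Ideal.span_singleton_eq_top.mpr h))

/-- Localizing the coefficients at `q = p ∩ R` does not change the local ring at `p`, and makes `p`
contract to the maximal ideal. -/
theorem isCohenMacaulayRing (hR : IsCohenMacaulayRing R) : IsCohenMacaulayRing R[X] where
  isNoetherianRing := have := hR.isNoetherianRing; inferInstance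
  localization p _ := by
    let q := p.comap C
    let S := (Localization.AtPrime q)[X]
    let pc := Submonoid.map Polynomial.C.toMonoidHom q.primeCompl
    let : Algebra R[X] S := algebra R (Localization.AtPrime q)
    have : IsLocalization pc S := Polynomial.isLocalization _ _
    let pS := p.map (algebraMap R[X] S)
    have disj : Disjoint (pc : Set R[X]) (p : Set R[X]) := by
      simpa [pc, q] using! Set.disjoint_image_left.mpr
        (Set.disjoint_compl_left_iff_subset.mpr (fun _ a ↦ a))
    have : pS.IsPrime := IsLocalization.isPrime_of_isPrime_disjoint pc _ _ ‹_› disj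
    have : IsLocalization.AtPrime (Localization.AtPrime pS) p := by
      convert IsLocalization.isLocalization_isLocalization_atPrime_isLocalization pc
        (Localization.AtPrime pS) pS
      exact (IsLocalization.under_map_of_isPrime_disjoint pc _ ‹_› disj).symm
    have eq : pS.comap C = maximalIdeal (Localization.AtPrime q) := by
      rw [← IsLocalization.map_under q.primeCompl _ (pS.comap C),
        ← IsLocalization.map_under q.primeCompl _ (maximalIdeal (Localization.AtPrime q))]
      simp only [Ideal.comap_comap, S, pS]
      rw [← Polynomial.algebraMap_eq (R := Localization.AtPrime q),
        ← IsScalarTower.algebraMap_eq R (Localization.AtPrime q) (Localization.AtPrime q)[X],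
        IsScalarTower.algebraMap_eq R R[X] (Localization.AtPrime q)[X], ← Ideal.comap_comap,
        ← Ideal.under_def R[X], IsLocalization.under_map_of_isPrime_disjoint pc _ ‹_› disj]
      simp [q, IsLocalization.AtPrime.under_maximalIdeal (Localization.AtPrime q) q]
    exact (isCohenMacaulayLocalRing_of_comap_eq_maximalIdeal (hR.localization q) pS eq).of_ringEquiv
      (IsLocalization.algEquiv p.primeCompl (Localization.AtPrime pS)
        (Localization.AtPrime p)).toRingEquiv

end Polynomial

theorem MvPolynomial.isCohenMacaulayRing {R : Type*} [CommRing R] (hR : IsCohenMacaulayRing R)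
    (ι : Type*) [Finite ι] : IsCohenMacaulayRing (MvPolynomial ι R) := by
  induction ι using Finite.induction_empty_option with
  | of_equiv e H => exact H.of_ringEquiv (renameEquiv _ e).toRingEquiv
  | h_empty => exact hR.of_ringEquiv (isEmptyRingEquiv R _).symm
  | h_option IH =>
    exact (Polynomial.isCohenMacaulayRing IH).of_ringEquiv
      (MvPolynomial.optionEquivLeft _ _).toRingEquiv.symm

/-! ### The deformed edge ideal and its basis of independent sets. -/

namespace SimpleGraph

open MvPolynomial

section DeformedIdeal

variable {V A : Type*} [CommRing A] (G : SimpleGraph V) (c : V → A)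

/-- The deformation of the edge ideal of `G` to which the squares `x_v ^ 2 - c_v x_v` are added. -/
noncomputable def deformedEdgeIdeal : Ideal (MvPolynomial V A) :=
  Ideal.span ({f | ∃ a b : V, G.Adj a b ∧ f = X a * X b} ∪
    {f | ∃ v : V, f = X v ^ 2 - C (c v) * X v})

variable {G} in
theorem X_mul_X_mem_deformedEdgeIdeal {u v : V} (h : G.Adj u v) :
    X u * X v ∈ G.deformedEdgeIdeal c :=
  Ideal.subset_span (Or.inl ⟨u, v, h, rfl⟩)

theorem X_sq_sub_mem_deformedEdgeIdeal (v : V) :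
    X v ^ 2 - C (c v) * X v ∈ G.deformedEdgeIdeal c :=
  Ideal.subset_span (Or.inr ⟨v, rfl⟩)

/-- The coefficient to which a monomial reduces modulo the relations `x_v ^ 2 = c_v x_v`. -/
def reductionCoeff (m : V →₀ ℕ) : A := ∏ v ∈ m.support, c v ^ (m v - 1)

open Classical in
/-- Reduction of polynomials to combinations of independent sets of vertices. -/
noncomputable def reduction :
    MvPolynomial V A →ₗ[A] ({F : Finset V // G.IsIndepSet (F : Set V)} →₀ A) :=
  (basisMonomials V A).constr A fun m =>
    if h : G.IsIndepSet (m.support : Set V) then Finsupp.single ⟨m.support, h⟩ (reductionCoeff c m)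
    else 0

theorem reduction_monomial_of_isIndepSet {m : V →₀ ℕ} (h : G.IsIndepSet (m.support : Set V)) :
    G.reduction c (monomial m 1) = Finsupp.single ⟨m.support, h⟩ (reductionCoeff c m) :=
  ((basisMonomials V A).constr_basis A _ m).trans (dif_pos h)

theorem reduction_monomial_of_not_isIndepSet {m : V →₀ ℕ}
    (h : ¬ G.IsIndepSet (m.support : Set V)) : G.reduction c (monomial m 1) = 0 :=
  ((basisMonomials V A).constr_basis A _ m).trans (dif_neg h)

theorem not_isIndepSet_of_adj {s : Set V} {u v : V} (h : G.Adj u v) (hu : u ∈ s) (hv : v ∈ s) :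
    ¬ G.IsIndepSet s := fun hs => hs hu hv h.ne h

theorem reduction_monomial_add_two (m : V →₀ ℕ) (v : V) :
    G.reduction c (monomial (m + Finsupp.single v 2) 1) =
      c v • G.reduction c (monomial (m + Finsupp.single v 1) 1) := by
  classical
  have hsupp : (m + Finsupp.single v 2).support = (m + Finsupp.single v 1).support := by
    ext w
    by_cases hw : v = w <;> simp [hw]
  have hv : v ∈ (m + Finsupp.single v 1).support := by simp
  -- At `v` the exponents `m v + 2` and `m v + 1` are positive, so the truncated `- 1` loses nothing
  -- and they differ by one factor `c v`.
  have hcoeff : reductionCoeff c (m + Finsupp.single v 2) =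
      c v * reductionCoeff c (m + Finsupp.single v 1) := by
    rw [reductionCoeff, reductionCoeff, hsupp, ← Finset.mul_prod_erase _ _ hv,
      ← Finset.mul_prod_erase _ _ hv, ← mul_assoc]
    congr 1
    · simp [pow_succ']
    · refine Finset.prod_congr rfl fun w hw => ?_
      simp [(Finset.ne_of_mem_erase hw).symm]
  by_cases h : G.IsIndepSet ((m + Finsupp.single v 1).support : Set V)
  · rw [reduction_monomial_of_isIndepSet G c h,
      reduction_monomial_of_isIndepSet G c (hsupp ▸ h), hcoeff, Finsupp.smul_single, smul_eq_mul]
    congr 1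
    exact Subtype.ext hsupp
  · rw [reduction_monomial_of_not_isIndepSet G c h,
      reduction_monomial_of_not_isIndepSet G c (hsupp ▸ h), smul_zero]

theorem reduction_eq_zero_of_mem {f : MvPolynomial V A} (hf : f ∈ G.deformedEdgeIdeal c) :
    G.reduction c f = 0 := by
  -- `reduction` is linear but not multiplicative, so each generator is tested against all monomial
  -- multipliers.
  have key : ∀ g : MvPolynomial V A, (∀ m : V →₀ ℕ, G.reduction c (monomial m 1 * g) = 0) →
      ∀ r : MvPolynomial V A, G.reduction c (r * g) = 0 := by
    intro g hg r
    have h : G.reduction c ∘ₗ LinearMap.mulRight A g = 0 :=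
      (basisMonomials V A).ext fun m => by simpa using hg m
    exact LinearMap.congr_fun h r
  induction hf using Submodule.closure_induction with
  | zero => exact map_zero _
  | add x y _ _ hx hy => rw [map_add, hx, hy, add_zero]
  | smul_mem r x hx =>
    rw [smul_eq_mul]
    refine key x (fun m => ?_) r
    rcases hx with ⟨a, b, hab, rfl⟩ | ⟨v, rfl⟩
    · rw [X, X, monomial_mul, monomial_mul, one_mul, one_mul]
      exact reduction_monomial_of_not_isIndepSet G c (G.not_isIndepSet_of_adj hab (by simp)
        (by simp))
    · have h1 : (X v ^ 2 : MvPolynomial V A) = monomial (Finsupp.single v 2) 1 := X_pow_eq_monomial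
      rw [mul_sub, h1, monomial_mul, one_mul, X, mul_left_comm, monomial_mul, one_mul, map_sub,
        ← smul_eq_C_mul, map_smul, reduction_monomial_add_two, sub_self]

theorem mk_X_pow (v : V) (k : ℕ) :
    Ideal.Quotient.mk (G.deformedEdgeIdeal c) (X v) ^ (k + 1) =
      Ideal.Quotient.mk (G.deformedEdgeIdeal c) (C (c v ^ k)) *
        Ideal.Quotient.mk (G.deformedEdgeIdeal c) (X v) := by
  have h := Ideal.Quotient.eq.mpr (G.X_sq_sub_mem_deformedEdgeIdeal c v)
  rw [map_pow, map_mul] at h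
  induction k with
  | zero => simp
  | succ k ih => rw [pow_succ, ih, mul_assoc, ← sq, h, ← mul_assoc, ← map_mul, ← C_mul, pow_succ]

theorem mk_monomial (m : V →₀ ℕ) :
    Ideal.Quotient.mk (G.deformedEdgeIdeal c) (monomial m 1) =
      Ideal.Quotient.mk (G.deformedEdgeIdeal c) (C (reductionCoeff c m)) *
        ∏ v ∈ m.support, Ideal.Quotient.mk (G.deformedEdgeIdeal c) (X v) := by
  rw [monomial_eq, C_1, one_mul, Finsupp.prod, map_prod, reductionCoeff, map_prod, map_prod,
    ← Finset.prod_mul_distrib]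
  refine Finset.prod_congr rfl fun v hv => ?_
  obtain ⟨k, hk⟩ := Nat.exists_eq_succ_of_ne_zero (Finsupp.mem_support_iff.mp hv)
  rw [map_pow, hk, Nat.succ_eq_add_one, mk_X_pow, Nat.add_sub_cancel]

theorem mk_monomial_of_not_isIndepSet {m : V →₀ ℕ} (h : ¬ G.IsIndepSet (m.support : Set V)) :
    Ideal.Quotient.mk (G.deformedEdgeIdeal c) (monomial m 1) = 0 := by
  classical
  obtain ⟨u, hu, v, hv, hne, hadj⟩ : ∃ u ∈ m.support, ∃ v ∈ m.support, u ≠ v ∧ G.Adj u v := by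
    simpa [IsIndepSet, Set.Pairwise] using h
  rw [mk_monomial, ← Finset.mul_prod_erase _ _ hu,
    ← Finset.mul_prod_erase _ _ (Finset.mem_erase.mpr ⟨hne.symm, hv⟩), ← mul_assoc (Ideal.Quotient.mk _ (X u)), ← map_mul _ (X u),
    Ideal.Quotient.eq_zero_iff_mem.mpr (X_mul_X_mem_deformedEdgeIdeal c hadj), zero_mul, mul_zero]

/-- Reduction on the quotient by the deformed edge ideal. -/
noncomputable def quotientReduction : (MvPolynomial V A ⧸ G.deformedEdgeIdeal c) →ₗ[A]
    ({F : Finset V // G.IsIndepSet (F : Set V)} →₀ A) where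
  toFun := Quotient.lift (G.reduction c) fun f g h => by
    have h' : f - g ∈ G.deformedEdgeIdeal c := (Submodule.quotientRel_def _).mp h
    rw [← sub_eq_zero, ← map_sub, G.reduction_eq_zero_of_mem c h']
  map_add' := by
    rintro ⟨f⟩ ⟨g⟩
    exact map_add (G.reduction c) f g
  map_smul' := by
    rintro a ⟨f⟩
    exact map_smul (G.reduction c) a f

@[simp]
theorem quotientReduction_mk (f : MvPolynomial V A) :
    G.quotientReduction c (Ideal.Quotient.mk _ f) = G.reduction c f := rfl

/-- Modulo the deformed edge ideal, the polynomial ring is free on the independent sets of `G`. -/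
noncomputable def deformedQuotientEquiv :
    (MvPolynomial V A ⧸ G.deformedEdgeIdeal c) ≃ₗ[A]
      ({F : Finset V // G.IsIndepSet (F : Set V)} →₀ A) :=
  LinearEquiv.ofLinearMap
    (G.quotientReduction c)
    (Finsupp.linearCombination A fun F =>
      ∏ v ∈ F.1, Ideal.Quotient.mk (G.deformedEdgeIdeal c) (X v))
    (by
      classical
      refine Finsupp.lhom_ext' fun F => LinearMap.ext_ring ?_
      have hF : (Finsupp.indicator F.1 fun _ _ => 1 : V →₀ ℕ).support = F.1 := by
        ext v; simp [Finsupp.indicator_apply]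
      have hX : ∏ v ∈ F.1, Ideal.Quotient.mk (G.deformedEdgeIdeal c) (X v) =
          Ideal.Quotient.mk (G.deformedEdgeIdeal c)
            (monomial (Finsupp.indicator F.1 fun _ _ => 1) 1) := by
        rw [monomial_eq, C_1, one_mul, Finsupp.prod, hF, ← map_prod]
        refine congrArg _ (Finset.prod_congr rfl fun v hv => ?_)
        rw [Finsupp.indicator_of_mem hv, pow_one]
      have hred := G.reduction_monomial_of_isIndepSet c
        (m := Finsupp.indicator F.1 fun _ _ => 1) (hF.symm ▸ F.2)
      have hcoeff : reductionCoeff c (Finsupp.indicator F.1 fun _ _ => 1) = 1 := by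
        refine Finset.prod_eq_one fun v hv => ?_
        rw [hF] at hv
        rw [Finsupp.indicator_of_mem hv, pow_zero]
      rw [LinearMap.comp_apply, LinearMap.comp_apply, Finsupp.lsingle_apply,
        Finsupp.linearCombination_single, one_smul, hX, quotientReduction_mk, hred, hcoeff]
      congr 1
      exact Subtype.ext hF)
    (by
      have key : (Finsupp.linearCombination A fun F : {F : Finset V // G.IsIndepSet (F : Set V)} =>
          ∏ v ∈ F.1, Ideal.Quotient.mk (G.deformedEdgeIdeal c) (X v)) ∘ₗ G.reduction c =
            (Ideal.Quotient.mkₐ A (G.deformedEdgeIdeal c)).toLinearMap := by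
        refine (basisMonomials V A).ext fun m => ?_
        simp only [coe_basisMonomials, LinearMap.comp_apply, AlgHom.toLinearMap_apply,
          Ideal.Quotient.mkₐ_eq_mk]
        by_cases h : G.IsIndepSet (m.support : Set V)
        · rw [reduction_monomial_of_isIndepSet G c h, Finsupp.linearCombination_single, mk_monomial]
          exact Algebra.smul_def (reductionCoeff c m)
            (∏ v ∈ m.support, Ideal.Quotient.mk (G.deformedEdgeIdeal c) (X v))
        · rw [reduction_monomial_of_not_isIndepSet G c h, map_zero,
            mk_monomial_of_not_isIndepSet G c h]
      refine LinearMap.ext fun x => ?_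
      obtain ⟨f, rfl⟩ := Ideal.Quotient.mk_surjective x
      exact LinearMap.congr_fun key f)

theorem isCohenMacaulayRing_deformedQuotient [Finite V] (hA : IsCohenMacaulayRing A) :
    IsCohenMacaulayRing (MvPolynomial V A ⧸ G.deformedEdgeIdeal c) := by
  have := hA.isNoetherianRing
  have : Module.Finite A (MvPolynomial V A ⧸ G.deformedEdgeIdeal c) :=
    Module.Finite.equiv (G.deformedQuotientEquiv c).symm
  have : Module.Free A (MvPolynomial V A ⧸ G.deformedEdgeIdeal c) :=
    Module.Free.of_equiv (G.deformedQuotientEquiv c).symm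
  exact hA.of_flat_of_isIntegral

end DeformedIdeal

end SimpleGraph

/-! ### The edge ring of the clique-whiskered graph as a deformed ring. -/

namespace SimpleGraph

open MvPolynomial

section CliqueWhiskering

variable {V : Type*} [Fintype V] [DecidableEq V] {G : SimpleGraph V}
  {π : Finpartition (Finset.univ : Finset V)}

theorem IsVertexCliquePartition.adj (hπ : G.IsVertexCliquePartition π) {W : π.parts} {u v : V}
    (hu : u ∈ W.1) (hv : v ∈ W.1) (h : u ≠ v) : G.Adj u v :=
  hπ W.1 W.2 hu hv h

variable (π) in
/-- The part of a partition of the whole type that contains a given element. -/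
def partOf (v : V) : π.parts := ⟨π.part v, π.part_mem.mpr (Finset.mem_univ v)⟩

theorem mem_partOf (v : V) : v ∈ (partOf π v).1 := π.mem_part (Finset.mem_univ v)

theorem partOf_eq {v : V} {W : π.parts} (h : v ∈ W.1) : partOf π v = W :=
  Subtype.ext (π.part_eq_of_mem W.2 h)

variable (G π) (K : Type*) [Field K]

/-- The edge ring of a clique-whiskered graph. -/
abbrev WhiskerRing : Type _ :=
  MvPolynomial (V ⊕ π.parts) K ⧸ (G.cliqueWhiskering π).edgeIdeal K

/-- The edge ring of `G` deformed along the parts of `π`. -/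
abbrev DeformedRing : Type _ :=
  MvPolynomial V (MvPolynomial π.parts K) ⧸
    G.deformedEdgeIdeal fun v => (X (partOf π v) : MvPolynomial π.parts K)

variable {G π} in
theorem mk_X_mul_X_eq_zero {a b : V ⊕ π.parts} (h : (G.cliqueWhiskering π).Adj a b) :
    (Ideal.Quotient.mk _ (X a) * Ideal.Quotient.mk _ (X b) : WhiskerRing G π K) = 0 := by
  rw [← map_mul, Ideal.Quotient.eq_zero_iff_mem]
  exact Ideal.subset_span ⟨a, b, h, rfl⟩

variable {G} in
theorem deformed_mk_X_mul_X_eq_zero {a b : V} (h : G.Adj a b) :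
    (Ideal.Quotient.mk _ (X a) * Ideal.Quotient.mk _ (X b) : DeformedRing G π K) = 0 := by
  rw [← map_mul, Ideal.Quotient.eq_zero_iff_mem]
  exact X_mul_X_mem_deformedEdgeIdeal _ h

/-- For pairwise orthogonal elements, multiplying the sum by one of them gives its square. -/
theorem mul_sum_eq_sq {ι R : Type*} [CommRing R] {s : Finset ι} {x : ι → R} {i : ι} (hi : i ∈ s)
    (h : ∀ j ∈ s, i ≠ j → x i * x j = 0) : x i * ∑ j ∈ s, x j = x i ^ 2 := by
  rw [Finset.mul_sum, Finset.sum_eq_single i (fun j hj hne => h j hj hne.symm)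
    (fun hi' => absurd hi hi'), sq]

/-- The images of the vertices of `G^π` in the deformed ring. -/
noncomputable def deformedVertex : V ⊕ π.parts → DeformedRing G π K
  | Sum.inl v => Ideal.Quotient.mk _ (X v)
  | Sum.inr W => Ideal.Quotient.mk _ (C (X W : MvPolynomial π.parts K)) -
      ∑ v ∈ W.1, Ideal.Quotient.mk _ (X v)

/-- The block sums `w_i + ∑_{v ∈ W_i} v` in the edge ring of `G^π`. -/
noncomputable def blockSum (W : π.parts) : WhiskerRing G π K :=
  Ideal.Quotient.mk _ (X (Sum.inr W)) + ∑ v ∈ W.1, Ideal.Quotient.mk _ (X (Sum.inl v))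

variable {G π}

/-- The clique kills the cross terms, leaving `x_v (y_W - ∑ x_u) = x_v y_W - x_v ^ 2`, a deformation
relation up to sign. -/
theorem deformedVertex_inl_mul_inr (hπ : G.IsVertexCliquePartition π) {v : V} {W : π.parts}
    (h : v ∈ W.1) : deformedVertex G π K (Sum.inl v) * deformedVertex G π K (Sum.inr W) = 0 := by
  have h1 := mul_sum_eq_sq (x := fun u : V => (Ideal.Quotient.mk _ (X u) : DeformedRing G π K)) h
    fun u hu hne => deformed_mk_X_mul_X_eq_zero π K (hπ.adj h hu hne)
  have h2 := Ideal.Quotient.eq.mpr (X_sq_sub_mem_deformedEdgeIdeal G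
    (fun v => (X (partOf π v) : MvPolynomial π.parts K)) v)
  rw [map_pow, map_mul, partOf_eq h, mul_comm] at h2
  rw [deformedVertex, deformedVertex, mul_sub, ← h2, sub_eq_zero]
  exact h1.symm

theorem mk_X_inl_mul_blockSum (hπ : G.IsVertexCliquePartition π) (v : V) :
    Ideal.Quotient.mk _ (X (Sum.inl v)) * blockSum G π K (partOf π v) =
      Ideal.Quotient.mk _ (X (Sum.inl v)) ^ 2 := by
  have h1 := mk_X_mul_X_eq_zero K
    (show (G.cliqueWhiskering π).Adj (Sum.inl v) (Sum.inr (partOf π v)) from mem_partOf v)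
  have h2 := mul_sum_eq_sq (x := fun u : V => (Ideal.Quotient.mk _ (X (Sum.inl u)) :
    WhiskerRing G π K)) (mem_partOf v) fun u hu hne => mk_X_mul_X_eq_zero K
      (show (G.cliqueWhiskering π).Adj (Sum.inl v) (Sum.inl u) from hπ.adj (mem_partOf v) hu hne)
  rw [blockSum, mul_add, h1, zero_add]
  exact h2

/-- The map from the edge ring of `G^π` to the deformed ring. -/
noncomputable def toDeformedRing (hπ : G.IsVertexCliquePartition π) :
    WhiskerRing G π K →+* DeformedRing G π K :=
  Ideal.Quotient.lift _
    (eval₂Hom ((Ideal.Quotient.mk _).comp (C.comp C)) (deformedVertex G π K)) <| by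
    intro f hf
    rw [← RingHom.mem_ker]
    refine Ideal.span_le.mpr ?_ hf
    rintro _ ⟨a, b, hab, rfl⟩
    rw [SetLike.mem_coe, RingHom.mem_ker, map_mul, eval₂Hom_X', eval₂Hom_X']
    rcases a with u | U <;> rcases b with v | W
    · exact deformed_mk_X_mul_X_eq_zero π K hab
    · exact deformedVertex_inl_mul_inr K hπ hab
    · exact (mul_comm _ _).trans (deformedVertex_inl_mul_inr K hπ hab)
    · exact hab.elim

/-- The map from the deformed ring to the edge ring of `G^π`. -/
noncomputable def ofDeformedRing (hπ : G.IsVertexCliquePartition π) :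
    DeformedRing G π K →+* WhiskerRing G π K :=
  Ideal.Quotient.lift _
    (eval₂Hom (eval₂Hom ((Ideal.Quotient.mk _).comp C) (blockSum G π K))
      fun v => Ideal.Quotient.mk _ (X (Sum.inl v))) <| by
    intro f hf
    rw [← RingHom.mem_ker]
    refine Ideal.span_le.mpr ?_ hf
    rintro _ (⟨a, b, hab, rfl⟩ | ⟨v, rfl⟩)
    · rw [SetLike.mem_coe, RingHom.mem_ker, map_mul, eval₂Hom_X', eval₂Hom_X']
      exact mk_X_mul_X_eq_zero K hab
    · rw [SetLike.mem_coe, RingHom.mem_ker, map_sub, map_mul, map_pow, eval₂Hom_X', eval₂Hom_C,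
        eval₂Hom_X', mul_comm, mk_X_inl_mul_blockSum K hπ, sub_self]

/-- The edge ring of `G^π` is isomorphic to the deformed ring. -/
noncomputable def deformedRingEquiv (hπ : G.IsVertexCliquePartition π) :
    DeformedRing G π K ≃+* WhiskerRing G π K :=
  RingEquiv.ofRingHom (ofDeformedRing K hπ) (toDeformedRing K hπ)
    (by
      refine Ideal.Quotient.ringHom_ext (MvPolynomial.ringHom_ext (fun a => ?_) fun x => ?_)
      · simp [ofDeformedRing, toDeformedRing]
      · rcases x with v | W
        · simp [ofDeformedRing, toDeformedRing, deformedVertex]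
        · simp [ofDeformedRing, toDeformedRing, deformedVertex, blockSum])
    (by
      refine Ideal.Quotient.ringHom_ext (MvPolynomial.ringHom_ext (fun a => ?_) fun v => ?_)
      -- The coefficients are themselves polynomials in the `y_W`, so a second extensionality is
      -- needed.
      · refine RingHom.congr_fun (MvPolynomial.ringHom_ext (f :=
          (((toDeformedRing K hπ).comp (ofDeformedRing K hπ)).comp (Ideal.Quotient.mk _)).comp C)
          (g := ((RingHom.id _).comp (Ideal.Quotient.mk _)).comp C) (fun a => ?_) fun W => ?_) a
        · simp [ofDeformedRing, toDeformedRing]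
        · simp [ofDeformedRing, toDeformedRing, deformedVertex, blockSum]
      · simp [ofDeformedRing, toDeformedRing, deformedVertex])

theorem IsVertexCliquePartition.isCohenMacaulayOver_cliqueWhiskering
    (hπ : G.IsVertexCliquePartition π) : (G.cliqueWhiskering π).IsCohenMacaulayOver K :=
  (isCohenMacaulayRing_deformedQuotient G _
    (MvPolynomial.isCohenMacaulayRing (.of_field K) π.parts)).of_ringEquiv (deformedRingEquiv K hπ)

/-- The clique-whiskered graph is the hybrid graph with singleton sets of new vertices. -/
def IsVertexCliquePartition.isoHybridGraph (hπ : G.IsVertexCliquePartition π) :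
    G.cliqueWhiskering π ≃g
      G.hybridGraph (fun W : π.parts => ((W : Finset V) : Set V)) (fun _ => Unit) where
  toEquiv := Equiv.sumCongr (Equiv.refl V) (Equiv.sigmaUnique π.parts fun _ => Unit).symm
  map_rel_iff' := by
    rintro (u | U) (v | W)
    · constructor
      · rintro (⟨u', v', h, hu, hv⟩ | ⟨hne, W, hu, hv⟩)
        · obtain rfl := Sum.inl_injective hu
          obtain rfl := Sum.inl_injective hv
          exact h
        · refine hπ.adj (W := W) ?_ ?_ fun h => hne (h ▸ rfl)
          · simpa [hybridBlock] using hu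
          · simpa [hybridBlock] using hv
      · exact fun h => Or.inl ⟨u, v, h, rfl, rfl⟩
    · simp [hybridGraph, hybridBlock, cliqueWhiskering, cliqueWhiskeringAdj]
    · simp [hybridGraph, hybridBlock, cliqueWhiskering, cliqueWhiskeringAdj]
    · simp only [hybridGraph, hybridBlock, cliqueWhiskering, cliqueWhiskeringAdj]
      aesop

end CliqueWhiskering

end SimpleGraph

theorem corollary2p7 {V : Type*} [Fintype V] [DecidableEq V] (G : SimpleGraph V)
    (π : Finpartition (Finset.univ : Finset V)) (hπ : G.IsVertexCliquePartition π) :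
    (∀ (K : Type*) [Field K], (G.cliqueWhiskering π).IsCohenMacaulayOver K) ∧
      ∃ e : G.cliqueWhiskering π ≃g
          G.hybridGraph (fun W : π.parts => ((W : Finset V) : Set V)) (fun _ => Unit),
        (∀ v : V, e (Sum.inl v) = Sum.inl v) ∧
          ∀ W : π.parts, e (Sum.inr W) = Sum.inr ⟨W, ()⟩ :=
  ⟨fun K _ => hπ.isCohenMacaulayOver_cliqueWhiskering K, hπ.isoHybridGraph,
    fun _ => rfl, fun _ => rfl⟩
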